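/- Conventions. For $k\ge 0$, a $k$-graph is a nonempty countable small category $\Lambda$ with a functor $d:\Lambda\to\mathbb{N}^k$ such that whenever $d(\lambda)=m+n$ there are unique $\mu,\nu\in\Lambda$ with $d(\mu)=m$, $d(\nu)=n$ and $\lambda=\mu\nu$. Write $r,s$ for range and source, $e_1,\dots,e_k$ for the generators of $\mathbb{N}^k$, $\Lambda^n=d^{-1}(n)$ and $v\Lambda^n=\{\lambda\in\Lambda^n: r(\lambda)=v\}$; $\Lambda^0$ is identified with the set of objects. $\Lambda$ is row-finite if every $v\Lambda^n$ is finite, and locally convex if, whenever $i\ne j$ and $\lambda\in\Lambda^{e_i}$ with $r(\lambda)\Lambda^{e_j}\neq\emptyset$, also $s(\lambda)\Lambda^{e_j}\ne\emptyset$. Let $Q_n(\Lambda)$ be the set of $\lambda\in\Lambda$ with $d(\lambda)\le(1,\dots,1)$ and $\sum_i d(\lambda)_i=n$, and let $C^n(\Lambda,\mathbb{T})$ be the group of all functions $Q_n(\Lambda)\to\mathbb{T}$. If $\lambda\in Q_{n+1}(\Lambda)$ has degree $e_{i_1}+\dots+e_{i_{n+1}}$ with $i_1<\dots<i_{n+1}$,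 its faces $F_j^0(\lambda),F_j^1(\lambda)\in Q_n(\Lambda)$ are determined by $F_j^0(\lambda)\beta=\lambda=\alpha F_j^1(\lambda)$ with $\alpha,\beta\in\Lambda^{e_{i_j}}$. Put $\delta^n(f)(\lambda)=\prod_{j=1}^{n+1}\prod_{l=0}^1 f(F_j^l(\lambda))^{(-1)^{j+l}}$ and $Z^n(\Lambda,\mathbb{T})=\ker\delta^n$. Let $\Lambda$ be row-finite and locally convex. For $\phi\in Z^2(\Lambda,\mathbb{T})$, a Cuntz-Krieger $\phi$-representation of $\Lambda$ in a $C^*$-algebra consists of mutually orthogonal projections $p_v$ ($v\in\Lambda^0$) and elements $s_\lambda$ ($\lambda\in\bigcup_i\Lambda^{e_i}=Q_1(\Lambda)$) such that (i) $s_\lambda^*s_\lambda=p_{s(\lambda)}$; (ii) $s_{\nu'}s_{\mu'}=\phi(\mu\nu)s_\mu s_\nu$ whenever $i<j$, $\mu,\mu'\in\Lambda^{e_i}$, $\nu,\nu'\in\Lambda^{e_j}$ and $\mu\nu=\nu'\mu'$; (iii) $p_v=\sum_{\lambda\in v\Lambda^{e_i}}s_\lambda s_\lambda^*$ whenever $v\Lambda^{e_i}\neq\emptyset$.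 Let $C^*_\phi(\Lambda)$ be the universal $C^*$-algebra generated by such a representation $\{p^\phi_v\},\{s^\phi_\lambda\}$. Let $C^*(\Lambda)$ be the universal $C^*$-algebra generated by a Cuntz-Krieger $\Lambda$-family, that is, partial isometries $\{t_\lambda:\lambda\in\Lambda\}$ such that the $t_v$, $v\in\Lambda^0$, are mutually orthogonal projections, $t_{\mu\nu}=t_\mu t_\nu$ for composable $\mu,\nu$, $t_\lambda^*t_\lambda=t_{s(\lambda)}$, and $t_v=\sum_{\lambda\in v\Lambda^{\le n}}t_\lambda t_\lambda^*$ for all $v\in\Lambda^0$, $n\in\mathbb{N}^k$, where $v\Lambda^{\le n}$ is the set of $\lambda$ with $r(\lambda)=v$, $d(\lambda)\le n$, and $s(\lambda)\Lambda^{e_i}=\emptyset$ whenever $d(\lambda)+e_i\le n$. Proposition. Let $\Lambda$ be a row-finite locally convex $k$-graph. (1) For the trivial cocycle $1$, there is an isomorphism $C^*_1(\Lambda)\to C^*(\Lambda)$ of $C^*$-algebras carrying $p^1_v$ to $t_v$ for all $v\in\Lambda^0$ and $s^1_\lambda$ to $t_\lambda$ for all $\lambda\in\bigcup_i\Lambda^{e_i}$.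 (2) If $\psi,\phi\in Z^2(\Lambda,\mathbb{T})$ and $\alpha\in C^1(\Lambda,\mathbb{T})$ satisfy $\phi=\delta^1(\alpha)\psi$, then there is an isomorphism $\pi:C^*_\psi(\Lambda)\to C^*_\phi(\Lambda)$ such that $\pi(p^\psi_v)=p^\phi_v$ for all $v\in\Lambda^0$ and $\pi(s^\psi_\lambda)=\alpha(\lambda)s^\phi_\lambda$ for all $\lambda\in\bigcup_i\Lambda^{e_i}$. -/

import Mathlib

universe u v w

noncomputable section

open scoped ENNReal

/-! ### The universal C⋆-algebra of a countable family of contractive generators -/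

namespace UniversalCStar

/-- A contractive realisation of the generators `X` subject to the relations `R` in a C⋆-algebra
whose underlying set consists of subsets of `ℕ`.  If `X` is countable, every C⋆-algebra generated
by a family indexed by `X` has at most the cardinality of the continuum, so up to isomorphism
these are all the C⋆-algebras generated by a realisation. -/
structure Realisation {X : Type u} (R : ∀ (A : Type) [NonUnitalCStarAlgebra A], (X → A) → Prop) where
  carrier : Set (Set ℕ)
  inst : NonUnitalCStarAlgebra carrier
  gen : X → carrier
  norm_gen_le : ∀ x, ‖gen x‖ ≤ 1
  rel : R carrier gen

attribute [instance] Realisation.inst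

/-- The C⋆-algebra of bounded families over all realisations. -/
abbrev Ambient {X : Type u} (R : ∀ (A : Type) [NonUnitalCStarAlgebra A], (X → A) → Prop) : Type u :=
  lp (fun i : Realisation R => (i.carrier : Type)) ∞

/-- The diagonal family of generators. -/
def diag {X : Type u} (R : ∀ (A : Type) [NonUnitalCStarAlgebra A], (X → A) → Prop) (x : X) :
    Ambient R :=
  ⟨fun i => i.gen x, memℓp_infty ⟨1, by rintro _ ⟨i, rfl⟩; exact i.norm_gen_le x⟩⟩

/-- The C⋆-subalgebra generated by the diagonal family. -/
def closedSpan {X : Type u} (R : ∀ (A : Type) [NonUnitalCStarAlgebra A], (X → A) → Prop) :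
    NonUnitalStarSubalgebra ℂ (Ambient R) :=
  (NonUnitalStarAlgebra.adjoin ℂ (Set.range (diag R))).topologicalClosure

/-- The universal (non-unital) C⋆-algebra generated by contractions indexed by `X`
satisfying the relations `R`. -/
def Alg {X : Type u} (R : ∀ (A : Type) [NonUnitalCStarAlgebra A], (X → A) → Prop) : Type u :=
  closedSpan R

instance {X : Type u} (R : ∀ (A : Type) [NonUnitalCStarAlgebra A], (X → A) → Prop) :
    NonUnitalCStarAlgebra (Alg R) :=
  NonUnitalStarSubalgebra.nonUnitalCStarAlgebra (closedSpan R)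
    (h_closed := NonUnitalStarSubalgebra.isClosed_topologicalClosure _)

/-- The universal generators. -/
def gen {X : Type u} (R : ∀ (A : Type) [NonUnitalCStarAlgebra A], (X → A) → Prop) (x : X) : Alg R :=
  ⟨diag R x, NonUnitalStarSubalgebra.le_topologicalClosure _
    (NonUnitalStarAlgebra.subset_adjoin ℂ _ ⟨x, rfl⟩)⟩

/-- Evaluation of the universal C⋆-algebra at a realisation. -/
def eval {X : Type u} (R : ∀ (A : Type) [NonUnitalCStarAlgebra A], (X → A) → Prop)
    (i : Realisation R) : Alg R →⋆ₙₐ[ℂ] (i.carrier : Type) where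
  toFun a := a.1.1 i
  map_smul' _ _ := rfl
  map_zero' := rfl
  map_add' _ _ := rfl
  map_mul' _ _ := rfl
  map_star' _ := rfl

theorem eval_gen {X : Type u} (R : ∀ (A : Type) [NonUnitalCStarAlgebra A], (X → A) → Prop)
    (i : Realisation R) (x : X) : eval R i (gen R x) = i.gen x := rfl

theorem eval_jointly_injective {X : Type u}
    (R : ∀ (A : Type) [NonUnitalCStarAlgebra A], (X → A) → Prop) (a b : Alg R)
    (h : ∀ i, eval R i a = eval R i b) : a = b :=
  Subtype.ext (Subtype.ext (funext h))

/-- The structure of a C⋆-algebra, transported along a bijection. -/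
abbrev transport {T : Type v} {B : Type w} [NonUnitalCStarAlgebra B] (e : T ≃ B) :
    NonUnitalCStarAlgebra T :=
  letI r : NonUnitalRing T := e.nonUnitalRing
  letI m : Module ℂ T := e.module ℂ
  letI n : NonUnitalNormedRing T := NonUnitalNormedRing.induced T B e.ringEquiv e.injective
  letI ns : NormedSpace ℂ T := { m with
    norm_smul_le := fun c x => by
      change ‖e (c • x)‖ ≤ _
      rw [show e (c • x) = c • e x from e.apply_symm_apply _]
      exact norm_smul_le c (e x) }
  have hmul : ∀ x y : T, e (x * y) = e x * e y := fun x y => e.apply_symm_apply _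
  have hadd : ∀ x y : T, e (x + y) = e x + e y := fun x y => e.apply_symm_apply _
  have hsmul : ∀ (c : ℂ) (x : T), e (c • x) = c • e x := fun c x => e.apply_symm_apply _
  letI st : StarRing T :=
    { star := fun x => e.symm (star (e x))
      star_involutive := fun x => e.injective (by
        change e (e.symm (star (e (e.symm (star (e x)))))) = e x
        simp)
      star_mul := fun x y => e.injective (by
        change e (e.symm (star (e (x * y)))) = e (e.symm (star (e y)) * e.symm (star (e x)))
        simp [hmul])
      star_add := fun x y => e.injective (by
        change e (e.symm (star (e (x + y)))) = e (e.symm (star (e x)) + e.symm (star (e y)))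
        simp [hadd]) }
  have hstar : ∀ x : T, e (star x) = star (e x) := fun x => e.apply_symm_apply _
  have hnorm : ∀ x : T, ‖x‖ = ‖e x‖ := fun x => rfl
  have hcs : CStarRing T := ⟨fun x => by
    rw [hnorm, hnorm, hmul, hstar]; exact CStarRing.norm_mul_self_le _⟩
  have hcomp : CompleteSpace T := by
    have hi : Isometry e := Isometry.of_dist_eq fun x y => rfl
    have hr : IsUniformInducing e := hi.isUniformInducing
    exact (completeSpace_congr (e := e) ⟨hr, e.injective⟩).2 inferInstance
  { n, st, ns, hcs, hcomp with
    smul_assoc := fun c x y => e.injective (by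
      change e ((c • x) * y) = e (c • (x * y))
      simp [hmul, hsmul, smul_mul_assoc])
    smul_comm := fun c x y => e.injective (by
      change e (c • (x * y)) = e (x * (c • y))
      simp [hmul, hsmul, mul_smul_comm])
    star_smul := fun c x => e.injective (by
      rw [hstar, hsmul, hsmul, hstar, star_smul]) }

/-- A C⋆-algebra generated by a countable set has at most the cardinality of the continuum. -/
theorem exists_injective_closure_adjoin {B : Type w} [NonUnitalCStarAlgebra B] {S : Set B}
    (hS : S.Countable) :
    ∃ f : (NonUnitalStarAlgebra.adjoin ℂ S).topologicalClosure → Set ℕ, Function.Injective f := by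
  have h1 : ((Subsemigroup.closure (S ∪ star S) : Subsemigroup B) : Set B).Countable := by
    have hc : (S ∪ star S).Countable := hS.union (by
      rw [← Set.image_star]; exact hS.image _)
    set W := S ∪ star S
    have : Countable W := hc.to_subtype
    let g : FreeSemigroup W →ₙ* B := FreeSemigroup.lift (fun x : W => (x : B))
    have hle : Subsemigroup.closure W ≤ g.srange := by
      rw [Subsemigroup.closure_le]
      intro x hx
      exact ⟨FreeSemigroup.of ⟨x, hx⟩, by simp [g]⟩
    have : Countable (FreeSemigroup W) :=
      Function.Injective.countable (f := fun t : FreeSemigroup W => (t.head, t.tail))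
        (fun a b h => by cases a; cases b; simp_all)
    refine (Set.countable_range g).mono fun x hx => ?_
    exact hle hx
  have h2 : TopologicalSpace.IsSeparable
      (((NonUnitalStarAlgebra.adjoin ℂ S).topologicalClosure : NonUnitalStarSubalgebra ℂ B) :
        Set B) := by
    have : TopologicalSpace.IsSeparable ((NonUnitalStarAlgebra.adjoin ℂ S : NonUnitalStarSubalgebra ℂ B) : Set B) := by
      have h3 := NonUnitalStarAlgebra.adjoin_eq_span (R := ℂ) S
      have h4 : ((NonUnitalStarAlgebra.adjoin ℂ S : NonUnitalStarSubalgebra ℂ B) : Set B)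
          = (Submodule.span ℂ ((Subsemigroup.closure (S ∪ star S) : Subsemigroup B) : Set B) :
            Set B) := by
        rw [← h3]; rfl
      rw [h4]
      exact h1.isSeparable.span
    exact this.closure
  have := h2.separableSpace
  set C := ((NonUnitalStarAlgebra.adjoin ℂ S).topologicalClosure : NonUnitalStarSubalgebra ℂ B)
  have : Nonempty C := ⟨0⟩
  let d := TopologicalSpace.denseSeq C
  have hd : DenseRange d := TopologicalSpace.denseRange_denseSeq C
  let q : C → Set (ℕ × ℕ) := fun x => {p | dist x (d p.1) < 1 / ((p.2 : ℝ) + 1)}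
  have hq : Function.Injective q := by
    intro x y hxy
    refine eq_of_forall_dist_le fun ε hε => ?_
    obtain ⟨n, hn⟩ := exists_nat_one_div_lt (half_pos hε)
    obtain ⟨m, hm⟩ := hd.exists_dist_lt x (ε := 1 / ((n : ℝ) + 1)) (by positivity)
    have hx : (m, n) ∈ q x := hm
    rw [hxy] at hx
    have hy : dist y (d m) < 1 / ((n : ℝ) + 1) := hx
    have := dist_triangle_right x y (d m)
    linarith
  exact ⟨fun x => Nat.pairEquiv '' q x, (Nat.pairEquiv.injective.image_injective).comp hq⟩

/-- Two ⋆-homomorphisms which agree on the universal generators are equal. -/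
theorem hom_ext {X : Type u} (R : ∀ (A : Type) [NonUnitalCStarAlgebra A], (X → A) → Prop)
    {B : Type w} [NonUnitalCStarAlgebra B] (π ρ : Alg R →⋆ₙₐ[ℂ] B)
    (h : ∀ x, π (gen R x) = ρ (gen R x)) : π = ρ := by
  have hc : ∀ σ : Alg R →⋆ₙₐ[ℂ] B, Continuous σ := fun σ =>
    AddMonoidHomClass.continuous_of_bound σ 1 (fun x => by
      simpa using NonUnitalStarAlgHom.norm_apply_le σ x)
  ext a
  obtain ⟨a, ha⟩ := a
  have key : ∀ b (hb : b ∈ NonUnitalStarAlgebra.adjoin ℂ (Set.range (diag R))),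
      π ⟨b, NonUnitalStarSubalgebra.le_topologicalClosure _ hb⟩ =
      ρ ⟨b, NonUnitalStarSubalgebra.le_topologicalClosure _ hb⟩ := by
    intro b hb
    induction hb using NonUnitalStarAlgebra.adjoin_induction with
    | mem x hx => obtain ⟨x, rfl⟩ := hx; exact h x
    | add x y hx hy h1 h2 =>
      exact (map_add π _ _).trans ((congrArg₂ (· + ·) h1 h2).trans (map_add ρ _ _).symm)
    | zero => exact (map_zero π).trans (map_zero ρ).symm
    | mul x y hx hy h1 h2 =>
      exact (map_mul π _ _).trans ((congrArg₂ (· * ·) h1 h2).trans (map_mul ρ _ _).symm)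
    | smul c x hx h1 =>
      exact (map_smul π c _).trans ((congrArg (c • ·) h1).trans (map_smul ρ c _).symm)
    | star x hx h1 =>
      exact (map_star π _).trans ((congrArg star h1).trans (map_star ρ _).symm)
  have hdense : DenseRange (fun b : (NonUnitalStarAlgebra.adjoin ℂ (Set.range (diag R))) =>
      (⟨b.1, NonUnitalStarSubalgebra.le_topologicalClosure _ b.2⟩ : Alg R)) := by
    intro x
    have hx : x.1 ∈ closure ((NonUnitalStarAlgebra.adjoin ℂ (Set.range (diag R)) :
      NonUnitalStarSubalgebra ℂ (Ambient R)) : Set (Ambient R)) := x.2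
    refine closure_subtype.2 ?_
    convert hx using 2
    ext y; constructor
    · rintro ⟨_, ⟨b, rfl⟩, rfl⟩; exact b.2
    · intro hy; exact ⟨⟨y, NonUnitalStarSubalgebra.le_topologicalClosure _ hy⟩, ⟨⟨y, hy⟩, rfl⟩, rfl⟩
  exact congrFun (hdense.equalizer (hc π) (hc ρ) (funext fun b => key b.1 b.2)) ⟨a, ha⟩

/-- The universal property: a contractive family `f` in a C⋆-algebra `B` extends to a
⋆-homomorphism, provided that its corestrictions to C⋆-subalgebras satisfy the relations. -/
theorem exists_lift {X : Type u} [Countable X]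
    (R : ∀ (A : Type) [NonUnitalCStarAlgebra A], (X → A) → Prop)
    {B : Type w} [NonUnitalCStarAlgebra B] (f : X → B) (hf : ∀ x, ‖f x‖ ≤ 1)
    (hR : ∀ (A : Type) [NonUnitalCStarAlgebra A] (g : X → A) (j : A →⋆ₙₐ[ℂ] B),
      Function.Injective j → (∀ x, j (g x) = f x) → R A g) :
    ∃ π : Alg R →⋆ₙₐ[ℂ] B, ∀ x, π (gen R x) = f x := by
  obtain ⟨q₀, hq₀⟩ := exists_injective_closure_adjoin (Set.countable_range f)
  let C := ((NonUnitalStarAlgebra.adjoin ℂ (Set.range f)).topologicalClosure :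
    NonUnitalStarSubalgebra ℂ B)
  let q : C → Set ℕ := q₀
  have hq : Function.Injective q := hq₀
  have hCc : IsClosed (C : Set B) := NonUnitalStarSubalgebra.isClosed_topologicalClosure _
  let iC : NonUnitalCStarAlgebra C :=
    NonUnitalStarSubalgebra.nonUnitalCStarAlgebra C (h_closed := hCc)
  let e : (Set.range q : Set (Set ℕ)) ≃ C := (Equiv.ofInjective q hq).symm
  let iT : NonUnitalCStarAlgebra (Set.range q : Set (Set ℕ)) := transport e
  let j : (Set.range q : Set (Set ℕ)) →⋆ₙₐ[ℂ] B :=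
    { toFun := fun t => (e t : B)
      map_smul' := fun c t => congrArg Subtype.val (e.apply_symm_apply (c • e t))
      map_zero' := congrArg Subtype.val (e.apply_symm_apply 0)
      map_add' := fun s t => congrArg Subtype.val (e.apply_symm_apply (e s + e t))
      map_mul' := fun s t => congrArg Subtype.val (e.apply_symm_apply (e s * e t))
      map_star' := fun t => congrArg Subtype.val (e.apply_symm_apply (star (e t))) }
  have hj : Function.Injective j := fun s t h => e.injective (Subtype.ext h)
  let g : X → (Set.range q : Set (Set ℕ)) := fun x => e.symm ⟨f x,
    NonUnitalStarSubalgebra.le_topologicalClosure _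
      (NonUnitalStarAlgebra.subset_adjoin ℂ _ ⟨x, rfl⟩)⟩
  have hg : ∀ x, j (g x) = f x := fun x => congrArg Subtype.val (e.apply_symm_apply _)
  let i : Realisation R :=
    { carrier := Set.range q
      inst := iT
      gen := g
      norm_gen_le := fun x => by
        change ‖j (g x)‖ ≤ 1
        rw [hg]; exact hf x
      rel := hR _ g j hj hg }
  exact ⟨j.comp (eval R i), fun x => hg x⟩

end UniversalCStar
/-! ### Higher-rank graphs, cubes and cohomology -/

open CategoryTheory

/-- `IsComp μ ν lam` says that `s(μ) = r(ν)` and `μν = lam`.  A path is an arrow from its source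
(`left`) to its range (`right`), so the product `μν` is the composite `ν ≫ μ`. -/
inductive IsComp {C : Type u} [Category.{v} C] :
    Quiver.Total C → Quiver.Total C → Quiver.Total C → Prop
  | mk {a b c : C} (μ : b ⟶ a) (ν : c ⟶ b) : IsComp ⟨b, a, μ⟩ ⟨c, b, ν⟩ ⟨c, a, ν ≫ μ⟩

/-- A `k`-graph: a nonempty countable small category with a degree functor to `ℕᵏ` which has the
factorisation property. -/
structure KGraph (k : ℕ) where
  Obj : Type u
  [cat : Category.{v} Obj]
  nonempty : Nonempty Obj
  countable_obj : Countable Obj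
  countable_mor : Countable (Quiver.Total Obj)
  /-- the degree of a path -/
  d : Quiver.Total Obj → (Fin k → ℕ)
  d_id : ∀ a : Obj, d ⟨a, a, 𝟙 a⟩ = 0
  d_comp : ∀ μ ν lam : Quiver.Total Obj, IsComp μ ν lam → d lam = d μ + d ν
  factorisation : ∀ (lam : Quiver.Total Obj) (m n : Fin k → ℕ), d lam = m + n →
    ∃! q : Quiver.Total Obj × Quiver.Total Obj, d q.1 = m ∧ d q.2 = n ∧ IsComp q.1 q.2 lam

attribute [instance] KGraph.cat KGraph.nonempty KGraph.countable_obj KGraph.countable_mor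

namespace KGraph

/-- The paths (morphisms) of `Λ`. -/
abbrev Path {k : ℕ} (Λ : KGraph.{u, v} k) : Type max u v := Quiver.Total Λ.Obj

/-- The vertex `v`, as a path of degree zero. -/
def vertex {k : ℕ} (Λ : KGraph.{u, v} k) (x : Λ.Obj) : Λ.Path := ⟨x, x, 𝟙 x⟩

/-- The source of a path. -/
abbrev s {k : ℕ} (Λ : KGraph.{u, v} k) (lam : Λ.Path) : Λ.Obj := lam.left

/-- The range of a path. -/
abbrev r {k : ℕ} (Λ : KGraph.{u, v} k) (lam : Λ.Path) : Λ.Obj := lam.right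

/-- The generator `eᵢ` of `ℕᵏ`. -/
def e {k : ℕ} (i : Fin k) : Fin k → ℕ := Pi.single i 1

/-- The set `vΛⁿ` of paths with range `v` and degree `n`. -/
def pathsInto {k : ℕ} (Λ : KGraph.{u, v} k) (x : Λ.Obj) (n : Fin k → ℕ) : Set Λ.Path :=
  {lam | Λ.r lam = x ∧ Λ.d lam = n}

/-- `Λ` is row-finite if every `vΛⁿ` is finite. -/
def RowFinite {k : ℕ} (Λ : KGraph.{u, v} k) : Prop :=
  ∀ (x : Λ.Obj) (n : Fin k → ℕ), (Λ.pathsInto x n).Finite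

/-- `Λ` is locally convex if, for `i ≠ j` and `lam ∈ Λ^{eᵢ}` with `r(lam)Λ^{eⱼ} ≠ ∅`, also
`s(lam)Λ^{eⱼ} ≠ ∅`. -/
def LocallyConvex {k : ℕ} (Λ : KGraph.{u, v} k) : Prop :=
  ∀ (i j : Fin k), i ≠ j → ∀ lam : Λ.Path, Λ.d lam = e i →
    (Λ.pathsInto (Λ.r lam) (e j)).Nonempty → (Λ.pathsInto (Λ.s lam) (e j)).Nonempty

/-- The set `Q_n(Λ)` of `n`-cubes: paths of degree at most `(1, …, 1)` and length `n`. -/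
def Q {k : ℕ} (Λ : KGraph.{u, v} k) (n : ℕ) : Type max u v :=
  {lam : Λ.Path // Λ.d lam ≤ 1 ∧ ∑ i, Λ.d lam i = n}

instance {k : ℕ} (Λ : KGraph.{u, v} k) (n : ℕ) : Countable (Λ.Q n) :=
  inferInstanceAs (Countable {lam : Λ.Path // Λ.d lam ≤ 1 ∧ ∑ i, Λ.d lam i = n})

/-- The `1`-cubes are exactly the edges, that is, the paths of degree some `eᵢ`. -/
theorem mem_Q_one_iff {k : ℕ} (Λ : KGraph.{u, v} k) (lam : Λ.Path) :
    (Λ.d lam ≤ 1 ∧ ∑ i, Λ.d lam i = 1) ↔ ∃ i, Λ.d lam = e i := by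
  constructor
  · rintro ⟨-, h⟩
    obtain ⟨i, -, hi⟩ := Finset.exists_ne_zero_of_sum_ne_zero (s := Finset.univ) (f := Λ.d lam)
      (by rw [h]; exact one_ne_zero)
    refine ⟨i, funext fun j => ?_⟩
    rw [← Finset.add_sum_erase _ _ (Finset.mem_univ i)] at h
    by_cases hji : j = i
    · subst hji; simp only [e, Pi.single_eq_same]; omega
    · have h3 := Finset.single_le_sum (f := Λ.d lam) (fun _ _ => Nat.zero_le _)
        (Finset.mem_erase.2 ⟨hji, Finset.mem_univ j⟩)
      simp only [e, Pi.single_eq_of_ne hji]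
      omega
  · rintro ⟨i, hi⟩
    rw [hi]
    refine ⟨fun j => ?_, by simp [e]⟩
    by_cases hji : j = i
    · subst hji; simp [e]
    · simp [e, hji]

/-- The set of directions `{i₁ < ⋯ < i_n}` in which a cube `lam` of degree `e_{i₁} + ⋯ + e_{i_n}`
extends. -/
def directions {k : ℕ} (Λ : KGraph.{u, v} k) {n : ℕ} (lam : Λ.Q n) : Finset (Fin k) :=
  Finset.univ.filter fun i => Λ.d lam.1 i ≠ 0

theorem card_directions {k : ℕ} (Λ : KGraph.{u, v} k) {n : ℕ} (lam : Λ.Q n) :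
    (Λ.directions lam).card = n := by
  rw [directions, Finset.card_filter]
  refine Eq.trans (Finset.sum_congr rfl fun i _ => ?_) lam.2.2
  have := lam.2.1 i
  simp only [Pi.one_apply] at this
  split_ifs <;> omega

/-- The `j`-th direction `i_{j+1}` of a cube, in increasing order (`j` is counted from zero). -/
def direction {k : ℕ} (Λ : KGraph.{u, v} k) {n : ℕ} (lam : Λ.Q n) (j : Fin n) : Fin k :=
  (Λ.directions lam).orderEmbOfFin (Λ.card_directions lam) j

/-- `μ` is the face `F_{j+1}^l(lam)`: there is `α` of degree the `j`-th direction of `lam` with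
`μα = lam` if `l = 0`, and with `αμ = lam` if `l = 1`. -/
def IsFace {k : ℕ} (Λ : KGraph.{u, v} k) {n : ℕ} (l : Fin 2) (j : Fin (n + 1)) (lam : Λ.Q (n + 1))
    (μ : Λ.Q n) : Prop :=
  ∃ α : Λ.Path, Λ.d α = e (Λ.direction lam j) ∧
    if l = 0 then IsComp μ.1 α lam.1 else IsComp α μ.1 lam.1

theorem existsUnique_isFace {k : ℕ} (Λ : KGraph.{u, v} k) {n : ℕ} (l : Fin 2) (j : Fin (n + 1))
    (lam : Λ.Q (n + 1)) : ∃! μ : Λ.Q n, Λ.IsFace l j lam μ := by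
  set i := Λ.direction lam j with hi
  have himem : i ∈ Λ.directions lam := Finset.orderEmbOfFin_mem _ _ _
  have hi0 : Λ.d lam.1 i ≠ 0 := by simpa [directions] using himem
  have hle : e i ≤ Λ.d lam.1 := fun a => by
    by_cases h : a = i
    · subst h; simp only [e, Pi.single_eq_same]; omega
    · simp [e, h]
  obtain ⟨m, hm⟩ : ∃ m, m = Λ.d lam.1 - e i := ⟨_, rfl⟩
  have hadd : Λ.d lam.1 = m + e i := by rw [hm, tsub_add_cancel_of_le hle]
  have hmQ : m ≤ 1 ∧ ∑ a, m a = n := by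
    refine ⟨hm ▸ (tsub_le_self.trans lam.2.1), ?_⟩
    have h := lam.2.2
    rw [hadd] at h
    simp only [Pi.add_apply, Finset.sum_add_distrib, e, Finset.sum_pi_single', Finset.mem_univ,
      if_true] at h
    omega
  fin_cases l
  · obtain ⟨⟨μ, α⟩, ⟨h1, h2, h3⟩, huniq⟩ := Λ.factorisation lam.1 m (e i) hadd
    refine ⟨⟨μ, by rw [show Λ.d μ = m from h1]; exact hmQ⟩, ⟨α, h2, by simpa using h3⟩, ?_⟩
    rintro ν ⟨β, hβ, hc⟩
    have hc' : IsComp ν.1 β lam.1 := by simpa using hc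
    have hd := Λ.d_comp _ _ _ hc'
    rw [hβ, ← hi, hadd] at hd
    have := huniq (ν.1, β) ⟨(add_right_cancel hd).symm, hβ, hc'⟩
    exact Subtype.ext (congrArg Prod.fst this)
  · obtain ⟨⟨α, μ⟩, ⟨h1, h2, h3⟩, huniq⟩ :=
      Λ.factorisation lam.1 (e i) m (hadd.trans (add_comm _ _))
    refine ⟨⟨μ, by rw [show Λ.d μ = m from h2]; exact hmQ⟩, ⟨α, h1, by simpa using h3⟩, ?_⟩
    rintro ν ⟨β, hβ, hc⟩
    have hc' : IsComp β ν.1 lam.1 := by simpa using hc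
    have hd := Λ.d_comp _ _ _ hc'
    rw [hβ, ← hi, hadd, add_comm] at hd
    have := huniq (β, ν.1) ⟨hβ, (add_left_cancel hd).symm, hc'⟩
    exact Subtype.ext (congrArg Prod.snd this)

/-- The face `F_{j+1}^l(lam)` of a cube (`j` is counted from zero). -/
def face {k : ℕ} (Λ : KGraph.{u, v} k) {n : ℕ} (l : Fin 2) (j : Fin (n + 1)) (lam : Λ.Q (n + 1)) :
    Λ.Q n :=
  (Λ.existsUnique_isFace l j lam).choose

theorem face_spec {k : ℕ} (Λ : KGraph.{u, v} k) {n : ℕ} (l : Fin 2) (j : Fin (n + 1))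
    (lam : Λ.Q (n + 1)) : Λ.IsFace l j lam (Λ.face l j lam) :=
  (Λ.existsUnique_isFace l j lam).choose_spec.1

/-- The group `Cⁿ(Λ, A)` of cubical `n`-cochains, for a multiplicative abelian group `A`. -/
abbrev Cochain {k : ℕ} (Λ : KGraph.{u, v} k) (n : ℕ) (A : Type w) : Type max u v w :=
  Λ.Q n → A

/-- The coboundary map `δⁿ : Cⁿ(Λ, A) → Cⁿ⁺¹(Λ, A)`, in multiplicative notation.  The exponent of
`f (F_i^l(lam))` is `(-1)^(i + l)`, where `i = j + 1`. -/
def δ {k : ℕ} (Λ : KGraph.{u, v} k) (n : ℕ) (A : Type w) [CommGroup A] :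
    Λ.Cochain n A →* Λ.Cochain (n + 1) A where
  toFun f lam := ∏ j : Fin (n + 1), ∏ l : Fin 2,
    f (Λ.face l j lam) ^ ((-1 : ℤ) ^ ((j : ℕ) + 1 + (l : ℕ)))
  map_one' := by ext lam; simp
  map_mul' f g := by ext lam; simp [mul_zpow, Finset.prod_mul_distrib]

/-- The group `Zⁿ(Λ, A)` of `n`-cocycles. -/
def Cocycle {k : ℕ} (Λ : KGraph.{u, v} k) (n : ℕ) (A : Type w) [CommGroup A] :
    Subgroup (Λ.Cochain n A) :=
  (Λ.δ n A).ker

/-! ### Cuntz–Krieger families -/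

/-- `(p, t)` is a Cuntz–Krieger `φ`-representation of the row-finite locally convex `k`-graph `Λ`
in the C⋆-algebra `A`.  The edges `⋃ᵢ Λ^{eᵢ}` are the elements of `Q₁(Λ)`.  By row-finiteness the
sum in the last condition is finite. -/
structure IsCKRep {k : ℕ} (Λ : KGraph.{u, v} k) (φ : Λ.Cocycle 2 Circle)
    {A : Type w} [NonUnitalCStarAlgebra A] (p : Λ.Obj → A) (t : Λ.Q 1 → A) : Prop where
  proj : ∀ x, IsStarProjection (p x)
  orthogonal : ∀ x y, x ≠ y → p x * p y = 0
  star_mul_self : ∀ f : Λ.Q 1, star (t f) * t f = p (Λ.s f.1)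
  twist : ∀ i j : Fin k, i < j → ∀ μ μ' ν ν' : Λ.Q 1,
    Λ.d μ.1 = e i → Λ.d μ'.1 = e i → Λ.d ν.1 = e j → Λ.d ν'.1 = e j →
    ∀ lam : Λ.Q 2, IsComp μ.1 ν.1 lam.1 → IsComp ν'.1 μ'.1 lam.1 →
      t ν' * t μ' = (φ.1 lam : ℂ) • (t μ * t ν)
  sum : ∀ (x : Λ.Obj) (i : Fin k), (Λ.pathsInto x (e i)).Nonempty →
    p x = ∑ᶠ f ∈ {f : Λ.Q 1 | f.1 ∈ Λ.pathsInto x (e i)}, t f * star (t f)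

/-- The set `vΛ^{≤n}` of paths `lam` with range `v` and `d(lam) ≤ n` such that `s(lam)Λ^{eᵢ} = ∅`
whenever `d(lam) + eᵢ ≤ n`. -/
def pathsLE {k : ℕ} (Λ : KGraph.{u, v} k) (x : Λ.Obj) (n : Fin k → ℕ) : Set Λ.Path :=
  {lam | Λ.r lam = x ∧ Λ.d lam ≤ n ∧
    ∀ i : Fin k, Λ.d lam + e i ≤ n → Λ.pathsInto (Λ.s lam) (e i) = ∅}

/-- `t` is a Cuntz–Krieger `Λ`-family in the C⋆-algebra `A`, for a row-finite locally convex
`k`-graph `Λ`.  By row-finiteness the sum in the last condition is finite. -/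
structure IsCKFamily {k : ℕ} (Λ : KGraph.{u, v} k)
    {A : Type w} [NonUnitalCStarAlgebra A] (t : Λ.Path → A) : Prop where
  partialIsometry : ∀ lam, t lam * star (t lam) * t lam = t lam
  proj : ∀ x, IsStarProjection (t (Λ.vertex x))
  orthogonal : ∀ x y, x ≠ y → t (Λ.vertex x) * t (Λ.vertex y) = 0
  mul : ∀ μ ν lam : Λ.Path, IsComp μ ν lam → t lam = t μ * t ν
  star_mul_self : ∀ lam, star (t lam) * t lam = t (Λ.vertex (Λ.s lam))
  sum : ∀ (x : Λ.Obj) (n : Fin k → ℕ),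
    t (Λ.vertex x) = ∑ᶠ lam ∈ Λ.pathsLE x n, t lam * star (t lam)

/-! ### The algebras `C⋆_φ(Λ)` and `C⋆(Λ)` -/

/-- The relations defining `C⋆_φ(Λ)`, on generators indexed by vertices and edges. -/
def ckRel {k : ℕ} (Λ : KGraph.{u, v} k) (φ : Λ.Cocycle 2 Circle) (A : Type)
    [NonUnitalCStarAlgebra A] (f : Λ.Obj ⊕ Λ.Q 1 → A) : Prop :=
  Λ.IsCKRep φ (fun x => f (Sum.inl x)) (fun g => f (Sum.inr g))

/-- The twisted `k`-graph algebra `C⋆_φ(Λ)`: the universal C⋆-algebra generated by a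
Cuntz–Krieger `φ`-representation of `Λ`. -/
abbrev TwistedAlgebra {k : ℕ} (Λ : KGraph.{u, v} k) (φ : Λ.Cocycle 2 Circle) : Type max u v :=
  UniversalCStar.Alg (Λ.ckRel φ)

/-- The universal generating projections `p_v` of `C⋆_φ(Λ)`. -/
def pUniv {k : ℕ} (Λ : KGraph.{u, v} k) (φ : Λ.Cocycle 2 Circle) (x : Λ.Obj) :
    Λ.TwistedAlgebra φ :=
  UniversalCStar.gen (Λ.ckRel φ) (Sum.inl x)

/-- The universal generating partial isometries `s_f` of `C⋆_φ(Λ)`, for edges `f`. -/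
def sUniv {k : ℕ} (Λ : KGraph.{u, v} k) (φ : Λ.Cocycle 2 Circle) (f : Λ.Q 1) :
    Λ.TwistedAlgebra φ :=
  UniversalCStar.gen (Λ.ckRel φ) (Sum.inr f)

/-- The `k`-graph algebra `C⋆(Λ)`: the universal C⋆-algebra generated by a Cuntz–Krieger
`Λ`-family. -/
abbrev GraphAlgebra {k : ℕ} (Λ : KGraph.{u, v} k) : Type max u v :=
  UniversalCStar.Alg fun (A : Type) [NonUnitalCStarAlgebra A] (t : Λ.Path → A) => Λ.IsCKFamily t

/-- The universal generating partial isometries of `C⋆(Λ)`, indexed by all paths. -/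
def tUniv {k : ℕ} (Λ : KGraph.{u, v} k) (lam : Λ.Path) : Λ.GraphAlgebra :=
  UniversalCStar.gen (fun (A : Type) [NonUnitalCStarAlgebra A] (t : Λ.Path → A) => Λ.IsCKFamily t)
    lam

/-! #### The universal properties -/

theorem norm_le_one_of_proj {A : Type w} [NonUnitalCStarAlgebra A] {p : A}
    (hp : IsStarProjection p) : ‖p‖ ≤ 1 := by
  have h : ‖p‖ * ‖p‖ = ‖p‖ := by
    rw [← CStarRing.norm_star_mul_self, hp.isSelfAdjoint.star_eq, hp.isIdempotentElem.eq]
  nlinarith [norm_nonneg p]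

theorem norm_le_one_of_star_mul_self {A : Type w} [NonUnitalCStarAlgebra A] {a p : A}
    (hp : IsStarProjection p) (h : star a * a = p) : ‖a‖ ≤ 1 := by
  have h1 : ‖a‖ * ‖a‖ ≤ 1 := by
    rw [← CStarRing.norm_star_mul_self, h]; exact norm_le_one_of_proj hp
  nlinarith [norm_nonneg a]

/-- A family of elements is a Cuntz–Krieger `φ`-representation if its images under a jointly
injective family of ⋆-homomorphisms are. -/
theorem IsCKRep.of_jointly_injective {k : ℕ} {Λ : KGraph.{u, v} k} (hΛ : Λ.RowFinite)
    {φ : Λ.Cocycle 2 Circle} {A : Type w} [NonUnitalCStarAlgebra A] {p : Λ.Obj → A}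
    {t : Λ.Q 1 → A} {ι : Type*} {B : ι → Type*} [∀ i, NonUnitalCStarAlgebra (B i)]
    (π : ∀ i, A →⋆ₙₐ[ℂ] B i) (hπ : ∀ a b, (∀ i, π i a = π i b) → a = b)
    (h : ∀ i, Λ.IsCKRep φ (fun x => π i (p x)) (fun f => π i (t f))) : Λ.IsCKRep φ p t where
  proj x := ⟨hπ _ _ fun i => by rw [map_mul]; exact ((h i).proj x).isIdempotentElem,
    hπ _ _ fun i => by rw [map_star]; exact ((h i).proj x).isSelfAdjoint⟩
  orthogonal x y hxy := hπ _ _ fun i => by rw [map_mul, map_zero]; exact (h i).orthogonal x y hxy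
  star_mul_self f := hπ _ _ fun i => by rw [map_mul, map_star]; exact (h i).star_mul_self f
  twist a b hab μ μ' ν ν' h1 h2 h3 h4 lam h5 h6 := hπ _ _ fun i => by
    rw [map_smul, map_mul, map_mul]; exact (h i).twist a b hab μ μ' ν ν' h1 h2 h3 h4 lam h5 h6
  sum x a hne := hπ _ _ fun i => by
    have hfin : {f : Λ.Q 1 | f.1 ∈ Λ.pathsInto x (e a)}.Finite :=
      (hΛ x (e a)).preimage Subtype.val_injective.injOn
    rw [(h i).sum x a hne, finsum_mem_eq_finite_toFinset_sum _ hfin,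
      finsum_mem_eq_finite_toFinset_sum _ hfin, map_sum]
    simp only [map_mul, map_star]

theorem finite_pathsLE {k : ℕ} {Λ : KGraph.{u, v} k} (hΛ : Λ.RowFinite) (x : Λ.Obj)
    (n : Fin k → ℕ) : (Λ.pathsLE x n).Finite := by
  refine ((Set.finite_Iic n).biUnion fun m _ => hΛ x m).subset fun lam h => ?_
  exact Set.mem_biUnion (Set.mem_Iic.2 h.2.1) ⟨h.1, rfl⟩

/-- A family of elements is a Cuntz–Krieger `Λ`-family if its images under a jointly injective
family of ⋆-homomorphisms are. -/
theorem IsCKFamily.of_jointly_injective {k : ℕ} {Λ : KGraph.{u, v} k} (hΛ : Λ.RowFinite)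
    {A : Type w} [NonUnitalCStarAlgebra A] {t : Λ.Path → A}
    {ι : Type*} {B : ι → Type*} [∀ i, NonUnitalCStarAlgebra (B i)]
    (π : ∀ i, A →⋆ₙₐ[ℂ] B i) (hπ : ∀ a b, (∀ i, π i a = π i b) → a = b)
    (h : ∀ i, Λ.IsCKFamily (fun f => π i (t f))) : Λ.IsCKFamily t where
  partialIsometry lam := hπ _ _ fun i => by
    rw [map_mul, map_mul, map_star]; exact (h i).partialIsometry lam
  proj x := ⟨hπ _ _ fun i => by rw [map_mul]; exact ((h i).proj x).isIdempotentElem,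
    hπ _ _ fun i => by rw [map_star]; exact ((h i).proj x).isSelfAdjoint⟩
  orthogonal x y hxy := hπ _ _ fun i => by rw [map_mul, map_zero]; exact (h i).orthogonal x y hxy
  mul μ ν lam hc := hπ _ _ fun i => by rw [map_mul]; exact (h i).mul μ ν lam hc
  star_mul_self f := hπ _ _ fun i => by rw [map_mul, map_star]; exact (h i).star_mul_self f
  sum x n := hπ _ _ fun i => by
    rw [(h i).sum x n, finsum_mem_eq_finite_toFinset_sum _ (finite_pathsLE hΛ x n),
      finsum_mem_eq_finite_toFinset_sum _ (finite_pathsLE hΛ x n), map_sum]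
    simp only [map_mul, map_star]

/-- The generators of `C⋆_φ(Λ)` form a Cuntz–Krieger `φ`-representation. -/
theorem isCKRep_univ {k : ℕ} (Λ : KGraph.{u, v} k) (hΛ : Λ.RowFinite) (φ : Λ.Cocycle 2 Circle) :
    Λ.IsCKRep φ (Λ.pUniv φ) (Λ.sUniv φ) :=
  IsCKRep.of_jointly_injective hΛ (UniversalCStar.eval (Λ.ckRel φ))
    (UniversalCStar.eval_jointly_injective _) fun i => i.rel

/-- The universal property of `C⋆_φ(Λ)`. -/
theorem existsUnique_lift_twisted {k : ℕ} (Λ : KGraph.{u, v} k) (hΛ : Λ.RowFinite)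
    (φ : Λ.Cocycle 2 Circle) {B : Type w} [NonUnitalCStarAlgebra B] {p : Λ.Obj → B}
    {t : Λ.Q 1 → B} (h : Λ.IsCKRep φ p t) :
    ∃! π : Λ.TwistedAlgebra φ →⋆ₙₐ[ℂ] B,
      (∀ x, π (Λ.pUniv φ x) = p x) ∧ ∀ f, π (Λ.sUniv φ f) = t f := by
  obtain ⟨π, hπ⟩ := UniversalCStar.exists_lift (Λ.ckRel φ) (Sum.elim p t)
    (by
      rintro (x | f)
      · exact norm_le_one_of_proj (h.proj x)
      · exact norm_le_one_of_star_mul_self (h.proj _) (h.star_mul_self f))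
    (fun A _ g j hj hg => by
      refine IsCKRep.of_jointly_injective hΛ (ι := Unit) (fun _ => j) (fun a b hab => hj (hab ()))
        fun _ => ?_
      simp only [hg, Sum.elim_inl, Sum.elim_inr]
      exact h)
  refine ⟨π, ⟨fun x => hπ (Sum.inl x), fun f => hπ (Sum.inr f)⟩, fun ρ hρ => ?_⟩
  refine UniversalCStar.hom_ext _ _ _ ?_
  rintro (x | f)
  · exact (hρ.1 x).trans (hπ (Sum.inl x)).symm
  · exact (hρ.2 f).trans (hπ (Sum.inr f)).symm

/-- The generators of `C⋆(Λ)` form a Cuntz–Krieger `Λ`-family. -/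
theorem isCKFamily_univ {k : ℕ} (Λ : KGraph.{u, v} k) (hΛ : Λ.RowFinite) :
    Λ.IsCKFamily Λ.tUniv :=
  IsCKFamily.of_jointly_injective hΛ (UniversalCStar.eval _)
    (UniversalCStar.eval_jointly_injective _) fun i => i.rel

/-- The universal property of `C⋆(Λ)`. -/
theorem existsUnique_lift_graphAlgebra {k : ℕ} (Λ : KGraph.{u, v} k) (hΛ : Λ.RowFinite)
    {B : Type w} [NonUnitalCStarAlgebra B] {t : Λ.Path → B} (h : Λ.IsCKFamily t) :
    ∃! π : Λ.GraphAlgebra →⋆ₙₐ[ℂ] B, ∀ lam, π (Λ.tUniv lam) = t lam := by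
  obtain ⟨π, hπ⟩ := UniversalCStar.exists_lift
    (fun (A : Type) [NonUnitalCStarAlgebra A] (t : Λ.Path → A) => Λ.IsCKFamily t) t
    (fun lam => norm_le_one_of_star_mul_self (h.proj _) (h.star_mul_self lam))
    (fun A _ g j hj hg => by
      refine IsCKFamily.of_jointly_injective hΛ (ι := Unit) (fun _ => j)
        (fun a b hab => hj (hab ())) fun _ => ?_
      simp only [hg]
      exact h)
  refine ⟨π, hπ, fun ρ hρ => UniversalCStar.hom_ext _ _ _ fun x => ?_⟩
  exact (hρ x).trans (hπ x).symm

end KGraph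

end

/-! Both isomorphisms come from universal properties: each algebra contains a family satisfying the
relations of the other, and the two induced homomorphisms are inverse because they are so on
generators.

For (2), rescale the edges by `α`. Around a square `μν = ν'μ'` the scalars collected are
`α(ν')α(μ')` on one side and `α(μ)α(ν)` on the other, and their discrepancy is `δ¹(α)`. Hence a
`φ`-representation becomes a `ψ`-representation (`IsCKRep.smul`), and `α⁻¹` undoes the change.

For (1), the edges of a Cuntz–Krieger family form a representation for the trivial cocycle
(`IsCKFamily.isCKRep`). The converse is the substance: the edge elements are multiplied along a
factorisation of a path into edges (`extend`). Two factorisations starting in different directions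
differ by exchanging the sides of a square, which the trivial cocycle does not see, so the product
is independent of choices (`extend_isComp_edge`). Multiplicativity and the formula for `t* t` follow
by induction on paths.

The sum over `xΛ^{≤n}` is obtained by induction on `|n|`, removing one `eᵢ` from `n` (`sum_extend`).
If `xΛ^{eᵢ}` is empty, this does not change the set. Otherwise local convexity forces every path of
the set to begin with an edge of degree `eᵢ`, unique by factorisation, and the inductive hypothesis
applies at the source of that edge. -/

open CategoryTheory

/-! ### Composition of paths -/

namespace IsComp

variable {C : Type u} [Category.{v} C] {a b c ab bc abc : Quiver.Total C}

theorem left_eq_right (h : IsComp a b c) : a.left = b.right := by cases h; rfl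

theorem left_eq (h : IsComp a b c) : c.left = b.left := by cases h; rfl

theorem right_eq (h : IsComp a b c) : c.right = a.right := by cases h; rfl

theorem exists_of_left_eq_right (h : a.left = b.right) : ∃ c, IsComp a b c := by
  obtain ⟨_, _, f⟩ := a
  obtain ⟨_, _, g⟩ := b
  obtain rfl : _ = _ := h
  exact ⟨_, .mk f g⟩

theorem unique {c' : Quiver.Total C} (h : IsComp a b c) (h' : IsComp a b c') : c = c' := by
  cases h; cases h'; rfl

theorem assoc_right (h : IsComp a b ab) (h' : IsComp ab c abc) :
    ∃ bc, IsComp b c bc ∧ IsComp a bc abc := by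
  cases h with
  | mk f g =>
    cases h' with
    | mk _ l => exact ⟨_, .mk g l, by rw [← Category.assoc]; exact .mk f (l ≫ g)⟩

theorem assoc_left (h : IsComp b c bc) (h' : IsComp a bc abc) :
    ∃ ab, IsComp a b ab ∧ IsComp ab c abc := by
  cases h with
  | mk g l =>
    cases h' with
    | mk f _ => exact ⟨_, .mk f g, by rw [Category.assoc]; exact .mk (g ≫ f) l⟩

end IsComp

namespace KGraph

/-! ### Unique factorisation and local convexity -/

section Paths

variable {k : ℕ} {Λ : KGraph.{u, v} k}

theorem isComp_vertex_left (lam : Λ.Path) : IsComp (Λ.vertex (Λ.r lam)) lam lam := by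
  obtain ⟨a, b, f⟩ := lam
  have := IsComp.mk (𝟙 b) f
  rwa [Category.comp_id] at this

theorem isComp_vertex_right (lam : Λ.Path) : IsComp lam (Λ.vertex (Λ.s lam)) lam := by
  obtain ⟨a, b, f⟩ := lam
  have := IsComp.mk f (𝟙 a)
  rwa [Category.id_comp] at this

theorem d_vertex (x : Λ.Obj) : Λ.d (Λ.vertex x) = 0 := Λ.d_id x

/-- Multiplying by the identity on the right or on the left gives two factorisations of `lam` in
degrees `0 + 0`; uniqueness identifies their left factors. -/
theorem eq_vertex_of_d_eq_zero {lam : Λ.Path} (h : Λ.d lam = 0) :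
    lam = Λ.vertex (Λ.r lam) := by
  have := (Λ.factorisation lam 0 0 (by simpa using h)).unique
    (y₁ := (lam, Λ.vertex (Λ.s lam))) (y₂ := (Λ.vertex (Λ.r lam), lam))
    ⟨h, d_vertex _, isComp_vertex_right _⟩ ⟨d_vertex _, h, isComp_vertex_left _⟩
  exact congrArg Prod.fst this

theorem e_le_iff {i : Fin k} {n : Fin k → ℕ} : e i ≤ n ↔ n i ≠ 0 := by
  refine ⟨fun h h0 => by simpa [e, h0] using h i, fun h j => ?_⟩
  by_cases hji : j = i
  · subst hji; simpa [e, Nat.one_le_iff_ne_zero] using h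
  · simp [e, hji]

/-- Edge and remainder are bundled as one pair so that `extend` can select both by a single choice.
-/
theorem exists_isComp_of_d_ne_zero {lam : Λ.Path} {i : Fin k} (h : Λ.d lam i ≠ 0) :
    ∃ q : Λ.Q 1 × Λ.Path, Λ.d q.1.1 = e i ∧ IsComp q.1.1 q.2 lam := by
  have hle : e i ≤ Λ.d lam := e_le_iff.2 h
  obtain ⟨⟨f, μ⟩, ⟨hf, -, hc⟩, -⟩ := Λ.factorisation lam (e i) (Λ.d lam - e i)
    (add_tsub_cancel_of_le hle).symm
  exact ⟨⟨⟨f, (Λ.mem_Q_one_iff f).2 ⟨i, hf⟩⟩, μ⟩, hf, hc⟩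

theorem exists_d_eq_e (f : Λ.Q 1) : ∃ i, Λ.d f.1 = e i := (Λ.mem_Q_one_iff f.1).1 f.2

/-- Left factors of the same degree agree, and so do the right factors. -/
theorem isComp_factors_unique {lam μ ν μ' ν' : Λ.Path} (h : IsComp μ ν lam)
    (h' : IsComp μ' ν' lam) (hd : Λ.d μ = Λ.d μ') : μ = μ' ∧ ν = ν' := by
  have h1 := Λ.d_comp _ _ _ h
  have h2 := Λ.d_comp _ _ _ h'
  have h3 : Λ.d ν' = Λ.d ν := by rw [h1, hd] at h2; exact (add_left_cancel h2).symm
  have := (Λ.factorisation lam _ _ h1).unique (y₁ := (μ, ν)) (y₂ := (μ', ν'))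
    ⟨rfl, rfl, h⟩ ⟨hd.symm, h3, h'⟩
  exact Prod.mk.inj this

theorem sum_d_isComp {f : Λ.Q 1} {μ lam : Λ.Path} (h : IsComp f.1 μ lam) :
    ∑ i, Λ.d lam i = ∑ i, Λ.d μ i + 1 := by
  rw [Λ.d_comp _ _ _ h]
  simp only [Pi.add_apply, Finset.sum_add_distrib, f.2.2, add_comm]

theorem pathsInto_nonempty_of_isComp {lam μ : Λ.Path} {f : Λ.Q 1} {i : Fin k}
    (h : IsComp f.1 μ lam) (hf : Λ.d f.1 = e i) : (Λ.pathsInto (Λ.r lam) (e i)).Nonempty :=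
  ⟨f.1, h.right_eq.symm, hf⟩

theorem d_apply_eq_zero_of_pathsInto_eq_empty {lam : Λ.Path} {i : Fin k}
    (h : Λ.pathsInto (Λ.r lam) (e i) = ∅) : Λ.d lam i = 0 := by
  by_contra h0
  obtain ⟨q, hq, hc⟩ := exists_isComp_of_d_ne_zero h0
  exact (pathsInto_nonempty_of_isComp hc hq).ne_empty h

/-- If no edge of degree `eᵢ` enters the range of `lam`, none enters its source. -/
theorem pathsInto_source_eq_empty {lam : Λ.Path} {i : Fin k}
    (h : Λ.pathsInto (Λ.r lam) (e i) = ∅) : Λ.pathsInto (Λ.s lam) (e i) = ∅ := by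
  rw [Set.eq_empty_iff_forall_notMem]
  rintro g ⟨hr, hg⟩
  obtain ⟨μ, hμ⟩ := IsComp.exists_of_left_eq_right hr.symm
  have h0 := d_apply_eq_zero_of_pathsInto_eq_empty (lam := μ) (i := i)
    (by rw [show Λ.r μ = Λ.r lam from hμ.right_eq]; exact h)
  rw [Λ.d_comp _ _ _ hμ, hg] at h0
  simp [e] at h0

/-- In a locally convex graph, if an edge of degree `eᵢ` enters the range of a path which does not
extend in direction `i`, then one enters its source. -/
theorem LocallyConvex.pathsInto_source_nonempty (hconv : Λ.LocallyConvex) {i : Fin k} :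
    ∀ (n : ℕ) (lam : Λ.Path), ∑ j, Λ.d lam j = n → Λ.d lam i = 0 →
      (Λ.pathsInto (Λ.r lam) (e i)).Nonempty → (Λ.pathsInto (Λ.s lam) (e i)).Nonempty := by
  intro n
  induction n with
  | zero =>
    intro lam hn _ hne
    have h0 : Λ.d lam = 0 := funext fun j => by simpa using (Finset.sum_eq_zero_iff.1 hn) j
    rw [eq_vertex_of_d_eq_zero h0] at hne ⊢
    exact hne
  | succ n ih =>
    intro lam hn hi hne
    obtain ⟨j, -, hj⟩ := Finset.exists_ne_zero_of_sum_ne_zero (s := Finset.univ) (f := Λ.d lam)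
      (by rw [hn]; omega)
    obtain ⟨⟨f, μ⟩, hf, hc⟩ := exists_isComp_of_d_ne_zero hj
    dsimp only at hf hc
    have hji : j ≠ i := by rintro rfl; exact hj hi
    rw [show Λ.s lam = Λ.s μ from hc.left_eq]
    rw [show Λ.r lam = Λ.r f.1 from hc.right_eq] at hne
    refine ih μ ?_ ?_ ?_
    · have := sum_d_isComp hc; omega
    · have := congrFun (Λ.d_comp _ _ _ hc) i
      simp only [Pi.add_apply] at this; omega
    · rw [show Λ.r μ = Λ.s f.1 from hc.left_eq_right.symm]
      exact hconv j i hji f.1 hf hne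

open Classical in
/-- The composite of two paths, with the value `μ` if they are not composable. -/
noncomputable def comp (μ ν : Λ.Path) : Λ.Path :=
  if h : ∃ lam, IsComp μ ν lam then h.choose else μ

theorem isComp_comp {μ ν : Λ.Path} (h : Λ.s μ = Λ.r ν) : IsComp μ ν (comp μ ν) := by
  have h' : ∃ lam, IsComp μ ν lam := IsComp.exists_of_left_eq_right h
  rw [comp, dif_pos h']
  exact h'.choose_spec

/-! ### Decomposition of the sets `xΛ^{≤n}` -/

theorem pathsLE_zero (x : Λ.Obj) : Λ.pathsLE x 0 = {Λ.vertex x} := by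
  ext lam
  constructor
  · rintro ⟨rfl, hd, -⟩
    exact eq_vertex_of_d_eq_zero (le_antisymm hd zero_le)
  · rintro rfl
    refine ⟨rfl, (d_vertex x).le, fun i hi => ?_⟩
    have := hi i
    simp [e] at this

/-- A path with range `x` has no component in direction `i`, and its source receives no edge of
degree `eᵢ` either. So both the degree bound and the maximality condition in direction `i` are
automatic. -/
theorem pathsLE_add_of_empty {x : Λ.Obj} {i : Fin k} {m : Fin k → ℕ}
    (h : Λ.pathsInto x (e i) = ∅) : Λ.pathsLE x (m + e i) = Λ.pathsLE x m := by
  ext lam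
  constructor
  · rintro ⟨rfl, hd, hs⟩
    have h0 := d_apply_eq_zero_of_pathsInto_eq_empty h
    refine ⟨rfl, fun j => ?_, fun j hj => hs j (hj.trans le_self_add)⟩
    by_cases hji : j = i
    · subst hji; rw [h0]; exact Nat.zero_le _
    · simpa [e, hji] using hd j
  · rintro ⟨rfl, hd, hs⟩
    have h0 := d_apply_eq_zero_of_pathsInto_eq_empty h
    refine ⟨rfl, hd.trans le_self_add, fun j hj => ?_⟩
    by_cases hji : j = i
    · subst hji; exact pathsInto_source_eq_empty h
    · refine hs j fun a => ?_
      by_cases hai : a = i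
      · subst hai
        simp [e, h0, Ne.symm hji]
      · simpa [e, hai] using hj a

/-- A path of the left-hand set with no component in direction `i` could, by local convexity, be
prolonged by an edge of degree `eᵢ`, against its maximality. Hence an edge of degree `eᵢ` splits off
in front, and maximality passes to and from the remainder because the source is the same. -/
theorem pathsLE_add_of_nonempty (hconv : Λ.LocallyConvex) {x : Λ.Obj} {i : Fin k}
    {m : Fin k → ℕ} (h : (Λ.pathsInto x (e i)).Nonempty) :
    Λ.pathsLE x (m + e i) = ⋃ f ∈ {f : Λ.Q 1 | f.1 ∈ Λ.pathsInto x (e i)},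
      comp f.1 '' Λ.pathsLE (Λ.s f.1) m := by
  ext lam
  simp only [Set.mem_iUnion, Set.mem_image, Set.mem_ofPred_eq, exists_prop]
  constructor
  · rintro ⟨rfl, hd, hs⟩
    have hi : Λ.d lam i ≠ 0 := fun h0 => by
      refine (hconv.pathsInto_source_nonempty _ lam rfl h0 h).ne_empty (hs i fun j => ?_)
      by_cases hji : j = i
      · subst hji; simp [h0]
      · simpa [e, hji] using hd j
    obtain ⟨⟨f, μ⟩, hf, hc⟩ := exists_isComp_of_d_ne_zero hi
    dsimp only at hf hc
    have hdc := Λ.d_comp _ _ _ hc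
    rw [hf, add_comm] at hdc
    refine ⟨f, ⟨hc.right_eq.symm, hf⟩, μ, ⟨hc.left_eq_right.symm, ?_, fun j hj => ?_⟩,
      (isComp_comp hc.left_eq_right).unique hc⟩
    · rw [hdc] at hd
      exact le_of_add_le_add_right hd
    · rw [show Λ.s μ = Λ.s lam from hc.left_eq.symm]
      refine hs j ?_
      rw [hdc, add_right_comm]
      exact add_le_add_left hj _
  · rintro ⟨f, ⟨rfl, hf⟩, μ, ⟨hr, hd, hs⟩, rfl⟩
    have hc := isComp_comp hr.symm
    have hdc := Λ.d_comp _ _ _ hc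
    rw [hf, add_comm] at hdc
    refine ⟨hc.right_eq, ?_, fun j hj => ?_⟩
    · rw [hdc]; exact add_le_add_left hd _
    · rw [show Λ.s (comp f.1 μ) = Λ.s μ from hc.left_eq]
      refine hs j ?_
      rw [hdc, add_right_comm] at hj
      exact le_of_add_le_add_right hj

/-- The only other candidate is the vertex `x`, which is not maximal since an edge of degree `eᵢ`
enters it. This is how the sum relation for edges is read off from the one for paths. -/
theorem pathsLE_e {x : Λ.Obj} {i : Fin k} (h : (Λ.pathsInto x (e i)).Nonempty) :
    Λ.pathsLE x (e i) = Λ.pathsInto x (e i) := by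
  ext lam
  constructor
  · rintro ⟨rfl, hd, hs⟩
    refine ⟨rfl, ?_⟩
    by_cases h0 : Λ.d lam i = 0
    · have hz : Λ.d lam = 0 := funext fun j => by
        by_cases hji : j = i
        · subst hji; exact h0
        · simpa [e, hji] using hd j
      refine absurd (hs i (by rw [hz, zero_add])) (Set.Nonempty.ne_empty ?_)
      rw [eq_vertex_of_d_eq_zero hz] at h ⊢
      exact h
    · exact le_antisymm hd (e_le_iff.2 h0)
  · rintro ⟨rfl, hd⟩
    refine ⟨rfl, hd.le, fun j hj => ?_⟩
    have := hj j
    simp [hd, e] at this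

end Paths

end KGraph

/-! ### Sums of squares in a C⋆-algebra -/

/-- Each summand is nonnegative in the spectral order, so each vanishes, and the C⋆-identity gives
`x i = 0`. -/
theorem NonUnitalCStarAlgebra.eq_zero_of_sum_mul_star_eq_zero {A ι : Type*}
    [NonUnitalCStarAlgebra A] {s : Finset ι} {x : ι → A} (h : ∑ i ∈ s, x i * star (x i) = 0)
    {i : ι} (hi : i ∈ s) : x i = 0 := by
  let _ := CStarAlgebra.spectralOrder A
  have := CStarAlgebra.spectralOrderedRing A
  exact CStarRing.mul_star_self_eq_zero_iff _ |>.1 <|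
    (Finset.sum_eq_zero_iff_of_nonneg fun i _ => mul_star_self_nonneg (x i)).1 h i hi

/-- If a projection `p` is a sum of elements `x * star x`, then `p * x = x` for each of them. -/
theorem IsStarProjection.mul_eq_of_eq_sum_mul_star {A ι : Type*} [NonUnitalCStarAlgebra A]
    {p : A} (hp : IsStarProjection p) {s : Finset ι} {x : ι → A}
    (h : p = ∑ i ∈ s, x i * star (x i)) {i : ι} (hi : i ∈ s) : p * x i = x i := by
  have hs : star p = p := hp.isSelfAdjoint.star_eq
  have hpp : p * p = p := hp.isIdempotentElem.eq
  -- Expanded and summed, this is `ppp - pp - pp + p`, which is zero.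
  have key : ∑ i ∈ s, (p * x i - x i) * star (p * x i - x i) = 0 := by
    have : ∀ i, (p * x i - x i) * star (p * x i - x i) =
        p * (x i * star (x i)) * p - p * (x i * star (x i)) - x i * star (x i) * p
          + x i * star (x i) := fun i => by
      rw [star_sub, star_mul, hs]; noncomm_ring
    simp only [this, Finset.sum_add_distrib, Finset.sum_sub_distrib, ← Finset.mul_sum,
      ← Finset.sum_mul, ← h, hpp]
    simp
  exact sub_eq_zero.1 (NonUnitalCStarAlgebra.eq_zero_of_sum_mul_star_eq_zero key hi)

/-- By the C⋆-identity it suffices that `(tp - t)*(tp - t)` vanishes, and it expands in terms of `t*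
t = p` alone. -/
theorem IsStarProjection.mul_eq_of_star_mul_self {A : Type*} [NonUnitalCStarAlgebra A]
    {p t : A} (hp : IsStarProjection p) (h : star t * t = p) : t * p = t := by
  have hs : star p = p := hp.isSelfAdjoint.star_eq
  have hpp : p * p = p := hp.isIdempotentElem.eq
  refine sub_eq_zero.1 ((CStarRing.star_mul_self_eq_zero_iff _).1 ?_)
  have : star (t * p - t) * (t * p - t) =
      p * (star t * t) * p - p * (star t * t) - star t * t * p + star t * t := by
    rw [star_sub, star_mul, hs]; noncomm_ring
  rw [this, h, hpp, hpp, sub_self, zero_sub, neg_add_cancel]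

namespace KGraph

variable {k : ℕ} {Λ : KGraph.{u, v} k} {A : Type w} [NonUnitalCStarAlgebra A]

/-! ### Extending a representation from edges to paths -/

open Classical in
/-- The product of the values of `t` along a factorisation of a path into edges. -/
noncomputable def extend (p : Λ.Obj → A) (t : Λ.Q 1 → A) (lam : Λ.Path) : A :=
  if h : ∃ i, Λ.d lam i ≠ 0 then
    -- The direction is an arbitrary choice; the edge and the remainder are then forced by unique
    -- factorisation.
    t (exists_isComp_of_d_ne_zero h.choose_spec).choose.1 *
      extend p t (exists_isComp_of_d_ne_zero h.choose_spec).choose.2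
  else p (Λ.r lam)
termination_by ∑ i, Λ.d lam i
decreasing_by
  have := sum_d_isComp (exists_isComp_of_d_ne_zero h.choose_spec).choose_spec.2
  omega

theorem extend_vertex (p : Λ.Obj → A) (t : Λ.Q 1 → A) (x : Λ.Obj) :
    extend p t (Λ.vertex x) = p x := by
  rw [extend, dif_neg]
  · rfl
  · simp [d_vertex]

/-- The usable form of the recursion: it forgets which direction was chosen. -/
theorem exists_extend_eq (p : Λ.Obj → A) (t : Λ.Q 1 → A) {lam : Λ.Path}
    (h : ∑ i, Λ.d lam i ≠ 0) : ∃ (i : Fin k) (f : Λ.Q 1) (μ : Λ.Path), Λ.d f.1 = e i ∧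
      IsComp f.1 μ lam ∧ extend p t lam = t f * extend p t μ := by
  have h' : ∃ i, Λ.d lam i ≠ 0 := by simpa using h
  refine ⟨_, _, _, (exists_isComp_of_d_ne_zero h'.choose_spec).choose_spec.1,
    (exists_isComp_of_d_ne_zero h'.choose_spec).choose_spec.2, ?_⟩
  rw [extend, dif_pos h']

/-- Induction on paths: a property which holds at vertices and is preserved by prepending an edge
holds for all paths. -/
theorem path_induction {P : Λ.Path → Prop} (vertex : ∀ x, P (Λ.vertex x))
    (edge : ∀ (f : Λ.Q 1) (μ lam : Λ.Path), IsComp f.1 μ lam → P μ → P lam) (lam : Λ.Path) :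
    P lam := by
  induction hn : ∑ i, Λ.d lam i generalizing lam with
  | zero =>
    have hz : Λ.d lam = 0 := funext fun j => by simpa using (Finset.sum_eq_zero_iff.1 hn) j
    rw [eq_vertex_of_d_eq_zero hz]
    exact vertex _
  | succ n ih =>
    obtain ⟨j, -, hj⟩ := Finset.exists_ne_zero_of_sum_ne_zero (s := Finset.univ) (f := Λ.d lam)
      (by rw [hn]; omega)
    obtain ⟨⟨f, μ⟩, -, hc⟩ := exists_isComp_of_d_ne_zero hj
    have := sum_d_isComp hc
    dsimp only at this
    exact edge f μ lam hc (ih μ (by omega))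

/-- An edge of degree `eᵢ` followed by one of degree `eⱼ`, with `i ≠ j`, forms a square. -/
theorem mem_Q_two {f g : Λ.Q 1} {i j : Fin k} (hij : i ≠ j) (hf : Λ.d f.1 = e i)
    (hg : Λ.d g.1 = e j) {lam : Λ.Path} (h : IsComp f.1 g.1 lam) :
    Λ.d lam ≤ 1 ∧ ∑ a, Λ.d lam a = 2 := by
  refine ⟨fun a => ?_, by rw [sum_d_isComp h, g.2.2]⟩
  rw [Λ.d_comp _ _ _ h, hf, hg]
  by_cases hi : a = i
  · subst hi; simp [e, hij]
  · by_cases hj : a = j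
    · subst hj; simp [e, hi]
    · simp [e, hi, hj]

/-! ### Faces and coboundaries of squares -/

theorem direction_two {i j : Fin k} (hij : i < j) {lam : Λ.Q 2} (h : Λ.d lam.1 = e i + e j) :
    Λ.direction lam = ![i, j] := by
  refine (Finset.orderEmbOfFin_unique (Λ.card_directions lam) (f := ![i, j]) ?_ ?_).symm
  · intro a
    fin_cases a <;> simp [directions, h, e]
  · rw [Fin.strictMono_iff_lt_succ]
    intro a
    fin_cases a
    exact hij

theorem face_eq {n : ℕ} {l : Fin 2} {j : Fin (n + 1)} {lam : Λ.Q (n + 1)} {μ : Λ.Q n}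
    (h : Λ.IsFace l j lam μ) : Λ.face l j lam = μ :=
  (Λ.existsUnique_isFace l j lam).unique (Λ.face_spec l j lam) h

/-- The coboundary of a `1`-cochain on the square `μν = ν'μ'`. -/
theorem δ_one_apply {G : Type*} [CommGroup G] (α : Λ.Cochain 1 G) {i j : Fin k} (hij : i < j)
    {μ μ' ν ν' : Λ.Q 1} (hμ : Λ.d μ.1 = e i) (hμ' : Λ.d μ'.1 = e i) (hν : Λ.d ν.1 = e j)
    (hν' : Λ.d ν'.1 = e j) {lam : Λ.Q 2} (hc : IsComp μ.1 ν.1 lam.1)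
    (hc' : IsComp ν'.1 μ'.1 lam.1) :
    Λ.δ 1 G α lam = (α ν')⁻¹ * α ν * (α μ * (α μ')⁻¹) := by
  have hdir := direction_two hij (lam := lam) (by rw [Λ.d_comp _ _ _ hc, hμ, hν])
  -- With `j` counted from zero, `face l j` has exponent `(-1)^(j + 1 + l)`: the faces `ν'` (`l = j
  -- = 0`) and `μ'` (`l = j = 1`) enter inverted, `ν` and `μ` do not.
  have h00 : Λ.face 0 0 lam = ν' := face_eq ⟨μ'.1, by rw [hdir]; exact hμ', by simpa using hc'⟩
  have h10 : Λ.face 1 0 lam = ν := face_eq ⟨μ.1, by rw [hdir]; exact hμ, by simpa using hc⟩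
  have h01 : Λ.face 0 1 lam = μ := face_eq ⟨ν.1, by rw [hdir]; exact hν, by simpa using hc⟩
  have h11 : Λ.face 1 1 lam = μ' := face_eq ⟨ν'.1, by rw [hdir]; exact hν', by simpa using hc'⟩
  simp [δ, Fin.prod_univ_two, h00, h10, h01, h11, pow_succ]

/-! ### From edge representations to Cuntz–Krieger families -/

namespace IsCKRep

variable {p : Λ.Obj → A} {t : Λ.Q 1 → A} {φ : Λ.Cocycle 2 Circle}

/-- Not one of the defining relations: it holds because `t f * star (t f)` is a summand of the
projection at the range of `f`. -/
theorem range_mul (hrow : Λ.RowFinite) (h : Λ.IsCKRep φ p t) (f : Λ.Q 1) :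
    p (Λ.r f.1) * t f = t f := by
  obtain ⟨i, hi⟩ := exists_d_eq_e f
  have hfin : {g : Λ.Q 1 | g.1 ∈ Λ.pathsInto (Λ.r f.1) (e i)}.Finite :=
    (hrow _ (e i)).preimage Subtype.val_injective.injOn
  have hs := h.sum (Λ.r f.1) i ⟨f.1, rfl, hi⟩
  rw [finsum_mem_eq_finite_toFinset_sum _ hfin] at hs
  exact (h.proj _).mul_eq_of_eq_sum_mul_star hs (hfin.mem_toFinset.2 ⟨rfl, hi⟩)

theorem mul_source (h : Λ.IsCKRep φ p t) (f : Λ.Q 1) : t f * p (Λ.s f.1) = t f :=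
  (h.proj _).mul_eq_of_star_mul_self (h.star_mul_self f)

/-- For the trivial cocycle, the representation is multiplicative around squares. -/
theorem commute_square (h : Λ.IsCKRep 1 p t) {i j : Fin k} (hij : i ≠ j) {f f' g g' : Λ.Q 1}
    (hf : Λ.d f.1 = e i) (hf' : Λ.d f'.1 = e i) (hg : Λ.d g.1 = e j) (hg' : Λ.d g'.1 = e j)
    {lam : Λ.Path} (hc : IsComp f.1 g.1 lam) (hc' : IsComp g'.1 f'.1 lam) :
    t f * t g = t g' * t f' := by
  have hQ := mem_Q_two hij hf hg hc
  rcases hij.lt_or_gt with hlt | hlt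
  · have := h.twist i j hlt f f' g g' hf hf' hg hg' ⟨lam, hQ⟩ hc hc'
    exact (this.trans (one_smul ℂ _)).symm
  · have := h.twist j i hlt g' g f' f hg' hg hf' hf ⟨lam, hQ⟩ hc' hc
    exact this.trans (one_smul ℂ _)

/-- Independence of the choices in `extend`, by induction on length. If the chosen first edge `g`
and the given `f` have the same degree, they agree. Otherwise both first edges lie on one square at
the start of `lam`, and the trivial cocycle lets that square be traversed either way. -/
theorem extend_isComp_edge (h : Λ.IsCKRep 1 p t) : ∀ (n : ℕ) (lam : Λ.Path),
    ∑ i, Λ.d lam i = n → ∀ (f : Λ.Q 1) (μ : Λ.Path), IsComp f.1 μ lam →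
      extend p t lam = t f * extend p t μ := by
  intro n
  induction n with
  | zero =>
    intro lam hn f μ hc
    have := sum_d_isComp hc
    omega
  | succ n ih =>
    intro lam hn f μ hc
    obtain ⟨i, g, ν, hg, hc', heq⟩ := exists_extend_eq p t (lam := lam) (by omega)
    obtain ⟨j, hf⟩ := exists_d_eq_e f
    by_cases hij : j = i
    · subst hij
      obtain ⟨h1, rfl⟩ := isComp_factors_unique hc hc' (hf.trans hg.symm)
      rw [heq, Subtype.ext h1]
    · have hd := Λ.d_comp _ _ _ hc
      rw [Λ.d_comp _ _ _ hc', hg, hf] at hd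
      -- Comparing `eᵢ + d(ν) = eⱼ + d(μ)` in the coordinate `i ≠ j`.
      have hμi : Λ.d μ i ≠ 0 := fun h0 => by
        have := congrFun hd i
        simp [e, h0, Ne.symm hij] at this
      obtain ⟨⟨g', ν'⟩, hg', hcμ⟩ := exists_isComp_of_d_ne_zero hμi
      dsimp only at hg' hcμ
      -- Now `lam = f g' ν'`; the square `σ = f g'` is refactored as `g'' f'`, starting in direction
      -- `i`.
      obtain ⟨σ, hσ, hσlam⟩ := IsComp.assoc_left hcμ hc
      have hσi : Λ.d σ i ≠ 0 := by
        rw [Λ.d_comp _ _ _ hσ, hf, hg']; simp [e]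
      obtain ⟨⟨g'', f'⟩, hg'', hcσ⟩ := exists_isComp_of_d_ne_zero hσi
      dsimp only at hg'' hcσ
      have hf' : Λ.d f' = e j := by
        have := Λ.d_comp _ _ _ hσ
        rw [Λ.d_comp _ _ _ hcσ, hf, hg', hg'', add_comm] at this
        exact add_right_cancel this
      obtain ⟨τ, hτ, hτlam⟩ := IsComp.assoc_right hcσ hσlam
      -- Both `g'' τ` and `g ν` factor `lam` with first edge of degree `eᵢ`, so `g'' = g` and `τ =
      -- ν`.
      obtain ⟨h1, rfl⟩ := isComp_factors_unique hτlam hc' (hg''.trans hg.symm)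
      obtain rfl := Subtype.ext h1
      let f'' : Λ.Q 1 := ⟨f', (Λ.mem_Q_one_iff f').2 ⟨j, hf'⟩⟩
      have hlen := sum_d_isComp hc
      have hlen' := sum_d_isComp hc'
      rw [heq, ih μ (by omega) g' ν' hcμ, ih τ (by omega) f'' ν' hτ, ← mul_assoc, ← mul_assoc,
        h.commute_square hij hf hf' hg' hg'' (f' := f'') hσ hcσ]

theorem range_mul_extend (hrow : Λ.RowFinite) (h : Λ.IsCKRep 1 p t) (lam : Λ.Path) :
    p (Λ.r lam) * extend p t lam = extend p t lam := by
  by_cases h0 : ∑ i, Λ.d lam i = 0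
  · have hz : Λ.d lam = 0 := funext fun j => by simpa using (Finset.sum_eq_zero_iff.1 h0) j
    rw [eq_vertex_of_d_eq_zero hz, extend_vertex]
    exact (h.proj _).isIdempotentElem.eq
  · obtain ⟨i, f, μ, -, hc, heq⟩ := exists_extend_eq p t h0
    rw [heq, show Λ.r lam = Λ.r f.1 from hc.right_eq, ← mul_assoc, h.range_mul hrow]

theorem extend_edge (h : Λ.IsCKRep 1 p t) (f : Λ.Q 1) : extend p t f.1 = t f := by
  rw [h.extend_isComp_edge _ _ rfl f _ (isComp_vertex_right f.1), extend_vertex, h.mul_source]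

/-- Induction on the left factor: its first edge is peeled off and the product reassociated. At a
vertex the claim is that the range projection acts as a left unit. -/
theorem extend_mul (hrow : Λ.RowFinite) (h : Λ.IsCKRep 1 p t) (μ : Λ.Path) :
    ∀ ν lam : Λ.Path, IsComp μ ν lam → extend p t lam = extend p t μ * extend p t ν := by
  induction μ using path_induction with
  | vertex x =>
    intro ν lam hc
    have hr : x = Λ.r ν := hc.left_eq_right
    subst hr
    rw [(isComp_vertex_left ν).unique hc |>.symm, extend_vertex, h.range_mul_extend hrow]
  | edge f μ σ hσ ih =>
    intro ν lam hc
    obtain ⟨τ, hτ, hτlam⟩ := IsComp.assoc_right hσ hc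
    rw [h.extend_isComp_edge _ _ rfl f _ hτlam, h.extend_isComp_edge _ _ rfl f _ hσ, ih ν τ hτ,
      mul_assoc]

/-- The product telescopes: the innermost `star (t f) * t f` is the projection at the range of the
remaining path, which absorbs it. -/
theorem star_extend_mul_self (hrow : Λ.RowFinite) (h : Λ.IsCKRep 1 p t) (lam : Λ.Path) :
    star (extend p t lam) * extend p t lam = p (Λ.s lam) := by
  induction lam using path_induction with
  | vertex x =>
    rw [extend_vertex, (h.proj x).isSelfAdjoint.star_eq, (h.proj x).isIdempotentElem.eq]
    rfl
  | edge f μ lam hc ih =>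
    rw [h.extend_isComp_edge _ _ rfl f _ hc, star_mul, mul_assoc, ← mul_assoc (star (t f)),
      h.star_mul_self, show Λ.s f.1 = Λ.r μ from hc.left_eq_right, h.range_mul_extend hrow, ih,
      show Λ.s lam = Λ.s μ from hc.left_eq]

theorem sum_extend (hrow : Λ.RowFinite) (hconv : Λ.LocallyConvex) (h : Λ.IsCKRep 1 p t) :
    ∀ (N : ℕ) (n : Fin k → ℕ), ∑ i, n i = N → ∀ x : Λ.Obj,
      p x = ∑ᶠ lam ∈ Λ.pathsLE x n, extend p t lam * star (extend p t lam) := by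
  intro N
  induction N with
  | zero =>
    intro n hn x
    obtain rfl : n = 0 := funext fun j => by simpa using (Finset.sum_eq_zero_iff.1 hn) j
    rw [pathsLE_zero, finsum_mem_singleton, extend_vertex, (h.proj x).isSelfAdjoint.star_eq,
      (h.proj x).isIdempotentElem.eq]
  | succ N ih =>
    intro n hn x
    obtain ⟨i, -, hi⟩ := Finset.exists_ne_zero_of_sum_ne_zero (s := Finset.univ) (f := n)
      (by rw [hn]; omega)
    obtain ⟨m, rfl⟩ : ∃ m, n = m + e i := ⟨n - e i, (tsub_add_cancel_of_le (e_le_iff.2 hi)).symm⟩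
    have hm : ∑ a, m a = N := by
      simp only [Pi.add_apply, Finset.sum_add_distrib, e, Finset.sum_pi_single', Finset.mem_univ,
        if_true] at hn
      omega
    rcases Set.eq_empty_or_nonempty (Λ.pathsInto x (e i)) with hemp | hne
    · rw [pathsLE_add_of_empty hemp]
      exact ih m hm x
    · have hfin : {f : Λ.Q 1 | f.1 ∈ Λ.pathsInto x (e i)}.Finite :=
        (hrow x (e i)).preimage Subtype.val_injective.injOn
      have hcomp : ∀ {f : Λ.Q 1} {μ : Λ.Path}, μ ∈ Λ.pathsLE (Λ.s f.1) m →
        IsComp f.1 μ (comp f.1 μ) := fun hμ => isComp_comp hμ.1.symm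
      -- Splitting the sum by first edge needs the images to be disjoint and each `comp f.1` to be
      -- injective; both are unique factorisation.
      rw [pathsLE_add_of_nonempty hconv hne, finsum_mem_biUnion ?_ hfin
        fun f _ => (finite_pathsLE hrow _ m).image _, h.sum x i hne]
      · refine finsum_mem_congr rfl fun f _ => ?_
        rw [finsum_mem_image ?_]
        · have hsum : t f * star (t f) = t f * p (Λ.s f.1) * star (t f) := by
            rw [h.mul_source]
          rw [hsum, ih m hm (Λ.s f.1), mul_finsum_mem' _ _ (finite_pathsLE hrow _ m),
            finsum_mem_mul' _ _ (finite_pathsLE hrow _ m)]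
          refine finsum_mem_congr rfl fun μ hμ => ?_
          rw [h.extend_isComp_edge _ _ rfl f μ (hcomp hμ), star_mul]
          simp only [mul_assoc]
        · intro μ hμ ν hν heq
          have h1 := hcomp hμ
          rw [show comp f.1 μ = comp f.1 ν from heq] at h1
          exact (isComp_factors_unique h1 (hcomp hν) rfl).2
      · intro f hf g hg hfg
        refine Set.disjoint_left.2 ?_
        rintro _ ⟨μ, hμ, rfl⟩ ⟨ν, hν, heq⟩
        have h1 := hcomp hμ
        rw [← heq] at h1
        exact hfg (Subtype.ext (isComp_factors_unique h1 (hcomp hν) (hf.2.trans hg.2.symm)).1)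

/-- A representation for the trivial cocycle extends to a Cuntz–Krieger family. -/
theorem isCKFamily_extend (hrow : Λ.RowFinite) (hconv : Λ.LocallyConvex) (h : Λ.IsCKRep 1 p t) :
    Λ.IsCKFamily (extend p t) where
  partialIsometry lam := by
    rw [mul_assoc, h.star_extend_mul_self hrow]
    exact (h.proj _).mul_eq_of_star_mul_self (h.star_extend_mul_self hrow lam)
  proj x := by rw [extend_vertex]; exact h.proj x
  orthogonal x y hxy := by rw [extend_vertex, extend_vertex]; exact h.orthogonal x y hxy
  mul μ ν lam hc := h.extend_mul hrow μ ν lam hc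
  star_mul_self lam := by rw [extend_vertex]; exact h.star_extend_mul_self hrow lam
  sum x n := by rw [extend_vertex]; exact h.sum_extend hrow hconv _ n rfl x

/-- Multiplying the edges by a `1`-cochain changes the cocycle by its coboundary. -/
theorem smul {ψ φ : Λ.Cocycle 2 Circle} {α : Λ.Cochain 1 Circle}
    (hα : (φ : Λ.Cochain 2 Circle) = Λ.δ 1 Circle α * ψ) (h : Λ.IsCKRep φ p t) :
    Λ.IsCKRep ψ p (fun f => (α f : ℂ) • t f) where
  proj := h.proj
  orthogonal := h.orthogonal
  star_mul_self f := by
    have hone : star (α f : ℂ) * (α f : ℂ) = 1 := by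
      rw [← starRingEnd_apply, ← Circle.coe_inv_eq_conj, ← Circle.coe_mul, inv_mul_cancel,
        Circle.coe_one]
    rw [star_smul, smul_mul_smul_comm, h.star_mul_self, hone, one_smul]
  twist i j hij μ μ' ν ν' hμ hμ' hν hν' lam hc hc' := by
    have hval : φ.1 lam = (α ν')⁻¹ * α ν * (α μ * (α μ')⁻¹) * ψ.1 lam := by
      rw [← δ_one_apply α hij hμ hμ' hν hν' hc hc']
      exact congrFun hα lam
    -- The coboundary relation cleared of inverses: the scalar identity that the rescaled square
    -- relation requires.
    have hmul : α ν' * α μ' * φ.1 lam = ψ.1 lam * (α μ * α ν) := by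
      calc α ν' * α μ' * φ.1 lam
          = α ν' * (α ν')⁻¹ * (α μ' * (α μ')⁻¹) * (ψ.1 lam * (α μ * α ν)) := by
            rw [hval]; ac_rfl
        _ = ψ.1 lam * (α μ * α ν) := by rw [mul_inv_cancel, mul_inv_cancel, one_mul, one_mul]
    rw [smul_mul_smul_comm, smul_mul_smul_comm, h.twist i j hij μ μ' ν ν' hμ hμ' hν hν' lam hc hc',
      smul_smul, smul_smul, ← Circle.coe_mul, ← Circle.coe_mul, ← Circle.coe_mul, ← Circle.coe_mul,
      hmul]
  sum x i hne := by
    rw [h.sum x i hne]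
    refine finsum_mem_congr rfl fun f _ => ?_
    have hone : (α f : ℂ) * star (α f : ℂ) = 1 := by
      rw [← starRingEnd_apply, ← Circle.coe_inv_eq_conj, ← Circle.coe_mul, mul_inv_cancel,
        Circle.coe_one]
    rw [star_smul, smul_mul_smul_comm, hone, one_smul]

end IsCKRep

/-- The edges of a Cuntz–Krieger family form a representation for the trivial cocycle. -/
theorem IsCKFamily.isCKRep {t : Λ.Path → A} (h : Λ.IsCKFamily t) :
    Λ.IsCKRep 1 (fun x => t (Λ.vertex x)) (fun f => t f.1) where
  proj := h.proj
  orthogonal := h.orthogonal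
  star_mul_self f := h.star_mul_self f.1
  twist i j _ μ μ' ν ν' _ _ _ _ lam hc hc' := by
    rw [← h.mul _ _ _ hc, ← h.mul _ _ _ hc']
    exact (one_smul ℂ _).symm
  sum x i hne := by
    have himg : Subtype.val '' {f : Λ.Q 1 | f.1 ∈ Λ.pathsInto x (e i)} = Λ.pathsInto x (e i) :=
      Set.image_preimage_eq_of_subset fun lam hlam =>
        ⟨⟨lam, (Λ.mem_Q_one_iff lam).2 ⟨i, hlam.2⟩⟩, rfl⟩
    rw [h.sum x (e i), pathsLE_e hne]
    conv_lhs => rw [← himg]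
    exact finsum_mem_image Subtype.val_injective.injOn

/-- The image of a Cuntz–Krieger family under a ⋆-homomorphism. -/
theorem IsCKFamily.map {B : Type*} [NonUnitalCStarAlgebra B] (hrow : Λ.RowFinite) {t : Λ.Path → A}
    (h : Λ.IsCKFamily t) (π : A →⋆ₙₐ[ℂ] B) : Λ.IsCKFamily fun lam => π (t lam) where
  partialIsometry lam := by rw [← map_star, ← map_mul, ← map_mul, h.partialIsometry]
  proj x := ⟨by rw [IsIdempotentElem, ← map_mul, (h.proj x).isIdempotentElem.eq],
    by rw [IsSelfAdjoint, ← map_star, (h.proj x).isSelfAdjoint.star_eq]⟩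
  orthogonal x y hxy := by rw [← map_mul, h.orthogonal x y hxy, map_zero]
  mul μ ν lam hc := by rw [← map_mul, h.mul _ _ _ hc]
  star_mul_self lam := by rw [← map_star, ← map_mul, h.star_mul_self]
  sum x n := by
    rw [h.sum x n, finsum_mem_eq_finite_toFinset_sum _ (finite_pathsLE hrow x n),
      finsum_mem_eq_finite_toFinset_sum _ (finite_pathsLE hrow x n), map_sum]
    simp only [map_mul, map_star]

/-- Two Cuntz–Krieger families which agree on vertices and edges are equal. -/
theorem IsCKFamily.ext {t t' : Λ.Path → A} (h : Λ.IsCKFamily t) (h' : Λ.IsCKFamily t')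
    (hv : ∀ x, t (Λ.vertex x) = t' (Λ.vertex x)) (he : ∀ f : Λ.Q 1, t f.1 = t' f.1) : t = t' := by
  funext lam
  induction lam using path_induction with
  | vertex x => exact hv x
  | edge f μ lam hc ih => rw [h.mul _ _ _ hc, h'.mul _ _ _ hc, he, ih]

end KGraph

/-! ### The two isomorphisms -/

theorem mainTheorem6 {k : ℕ} (Λ : KGraph.{u, v} k) (hrow : Λ.RowFinite) (hconv : Λ.LocallyConvex) :
    (∃ π : Λ.TwistedAlgebra 1 ≃⋆ₐ[ℂ] Λ.GraphAlgebra,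
      (∀ x : Λ.Obj, π (Λ.pUniv 1 x) = Λ.tUniv (Λ.vertex x)) ∧
      ∀ f : Λ.Q 1, π (Λ.sUniv 1 f) = Λ.tUniv f.1) ∧
    ∀ (ψ φ : Λ.Cocycle 2 Circle) (α : Λ.Cochain 1 Circle),
      (φ : Λ.Cochain 2 Circle) = Λ.δ 1 Circle α * ψ →
      ∃ π : Λ.TwistedAlgebra ψ ≃⋆ₐ[ℂ] Λ.TwistedAlgebra φ,
        (∀ x : Λ.Obj, π (Λ.pUniv ψ x) = Λ.pUniv φ x) ∧
        ∀ f : Λ.Q 1, π (Λ.sUniv ψ f) = (α f : ℂ) • Λ.sUniv φ f := by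
  constructor
  · obtain ⟨π, ⟨hπp, hπs⟩, -⟩ :=
      Λ.existsUnique_lift_twisted hrow 1 (Λ.isCKFamily_univ hrow).isCKRep
    have hrep := Λ.isCKRep_univ hrow 1
    obtain ⟨ρ, hρ, -⟩ :=
      Λ.existsUnique_lift_graphAlgebra hrow (hrep.isCKFamily_extend hrow hconv)
    have hρv : ∀ x, ρ (Λ.tUniv (Λ.vertex x)) = Λ.pUniv 1 x := fun x => by
      rw [hρ, KGraph.extend_vertex]
    have hρe : ∀ f : Λ.Q 1, ρ (Λ.tUniv f.1) = Λ.sUniv 1 f := fun f => by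
      rw [hρ, hrep.extend_edge]
    have h1 : ρ.comp π = NonUnitalStarAlgHom.id ℂ _ := by
      refine (Λ.existsUnique_lift_twisted hrow 1 hrep).unique ⟨fun x => ?_, fun f => ?_⟩
        ⟨fun _ => rfl, fun _ => rfl⟩
      · exact (congrArg ρ (hπp x)).trans (hρv x)
      · exact (congrArg ρ (hπs f)).trans (hρe f)
    have h2 : π.comp ρ = NonUnitalStarAlgHom.id ℂ _ := by
      have hfam := Λ.isCKFamily_univ hrow
      have hfam' : Λ.IsCKFamily fun lam => π (ρ (Λ.tUniv lam)) := hfam.map hrow (π.comp ρ)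
      refine (Λ.existsUnique_lift_graphAlgebra hrow hfam).unique (fun lam => ?_) fun _ => rfl
      -- The generators of `Λ.GraphAlgebra` are all paths, but a Cuntz–Krieger family is determined
      -- by its vertices and edges.
      refine congrFun (hfam'.ext hfam (fun x => ?_) fun f => ?_) lam
      · rw [hρv, hπp]
      · rw [hρe, hπs]
    exact ⟨.ofNonUnitalStarAlgHom π ρ h1 h2, hπp, hπs⟩
  · intro ψ φ α hα
    -- The relation is symmetric under `α ↦ α⁻¹`, which supplies the inverse homomorphism.
    have hα' : (ψ : Λ.Cochain 2 Circle) = Λ.δ 1 Circle α⁻¹ * φ := by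
      rw [hα, map_inv, inv_mul_cancel_left]
    have hψ := Λ.isCKRep_univ hrow ψ
    have hφ := Λ.isCKRep_univ hrow φ
    obtain ⟨π, ⟨hπp, hπs⟩, -⟩ := Λ.existsUnique_lift_twisted hrow ψ (hφ.smul hα)
    obtain ⟨ρ, ⟨hρp, hρs⟩, -⟩ := Λ.existsUnique_lift_twisted hrow φ (hψ.smul hα')
    have h1 : ρ.comp π = NonUnitalStarAlgHom.id ℂ _ := by
      refine (Λ.existsUnique_lift_twisted hrow ψ hψ).unique ⟨fun x => ?_, fun f => ?_⟩
        ⟨fun _ => rfl, fun _ => rfl⟩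
      · exact (congrArg ρ (hπp x)).trans (hρp x)
      · refine (congrArg ρ (hπs f)).trans ?_
        rw [map_smul, hρs, smul_smul, ← Circle.coe_mul, Pi.inv_apply, mul_inv_cancel,
          Circle.coe_one, one_smul]
    have h2 : π.comp ρ = NonUnitalStarAlgHom.id ℂ _ := by
      refine (Λ.existsUnique_lift_twisted hrow φ hφ).unique ⟨fun x => ?_, fun f => ?_⟩
        ⟨fun _ => rfl, fun _ => rfl⟩
      · exact (congrArg π (hρp x)).trans (hπp x)
      · refine (congrArg π (hρs f)).trans ?_
        rw [map_smul, hπs, smul_smul, ← Circle.coe_mul, Pi.inv_apply, inv_mul_cancel,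
          Circle.coe_one, one_smul]
    exact ⟨.ofNonUnitalStarAlgHom π ρ h1 h2, hπp, hπs⟩
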